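/- Let $n\ge 1$, $N=2^n$, and let $S\subseteq\{0,1\}^n$ be a non-empty set of $M=|S|$ marked strings, all of the same Hamming weight $n_i$, such that $|S_1\rangle=\frac1{\sqrt M}\sum_{x\in S}|x\rangle$ is symmetric, i.e. invariant under all permutations of the $n$ qubits (so $M=\binom{n}{n_i}$). Let $\theta=\arcsin\sqrt{M/N}$, $\theta_k=(2k+1)\theta$, and let $|\psi_{k,M}\rangle=G^k|\psi_0\rangle$ be the state of Grover's algorithm after $k$ iterations, where $|\psi_0\rangle=\frac1{\sqrt N}\sum_{x}|x\rangle$, $G=(2|\psi_0\rangle\langle\psi_0|-I)\,O$, and $O$ changes the sign of exactly the marked basis states. Let $k_{opt}$ be the integer closest to $\frac12\left(\frac{\pi}{2\theta}-1\right)$ (rounded up in case of a tie). Let $E(|\psi\rangle)=1-\max_{\phi}|\langle\psi|\phi\rangle|^2$, with the maximum over all $|\phi\rangle=\bigotimes_{s=1}^n|\phi_s\rangle$ with single-qubit unit vectors $|\phi_s\rangle$, be the geometric measure of entanglement. Define the turning point by $\theta_{k_T}=\arctan(1/B_{\max})$, where $$B_{\max}=\max_{\alpha\in[0,\pi]}\frac1{\sqrt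 M}\sum_{x\in S}\cos^{n-|x|}\tfrac{\alpha}{2}\,\sin^{|x|}\tfrac{\alpha}{2}$$ and $|x|$ is the Hamming weight of $x$. Then, with the convention $0^0=1$, $$\theta_{k_T}=\arctan\left(\frac{\left(1-\frac{n_i}{n}\right)^{\frac{n_i-n}{2}}\left(\frac{n_i}{n}\right)^{-\frac{n_i}{2}}}{\sqrt M}\right),$$ and, when $N\gg M$, for all $0\le k\le k_{opt}$, $$E(|\psi_{k,M}\rangle)\simeq\begin{cases}\sin^2\theta_k, & \theta_k\le\theta_{k_T},\\[2pt] 1-M\sin^2\theta_k\left(1-\frac{n_i}{n}\right)^{n-n_i}\left(\frac{n_i}{n}\right)^{n_i}, & \theta_k>\theta_{k_T}.\end{cases}$$ Here $\simeq$ means: for every $\varepsilon>0$ there is a $C>0$, depending only on $\varepsilon$, such that whenever $N\ge C M$ the two sides differ by at most $\varepsilon$, for all such $n$, $n_i$, $S$ and all $0\le k\le k_{opt}$. -/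

import Mathlib

/-- Vectors of an `n`-qubit system; the computational basis is indexed by bit strings. -/
abbrev QubitSpace (n : ℕ) : Type := EuclideanSpace ℂ (Fin n → Fin 2)

/-- The equal superposition `(1/√|S|) ∑_{x ∈ S} |x⟩` of a set `S` of bit strings. -/
noncomputable def uniformState {n : ℕ} (S : Finset (Fin n → Fin 2)) : QubitSpace n :=
  WithLp.toLp 2 (fun x => if x ∈ S then (((1 / Real.sqrt (S.card : ℝ) : ℝ)) : ℂ) else 0)

/-- The uniform superposition of all `N = 2^n` bit strings, Grover's initial state. -/
noncomputable def initialState (n : ℕ) : QubitSpace n :=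
  uniformState (Finset.univ : Finset (Fin n → Fin 2))

/-- The phase oracle: it flips the sign of the amplitudes of the marked strings. -/
noncomputable def oracle {n : ℕ} (S : Finset (Fin n → Fin 2)) (ψ : QubitSpace n) :
    QubitSpace n :=
  WithLp.toLp 2 (fun x => if x ∈ S then -(ψ x) else ψ x)

/-- The reflection `2|ψ₀⟩⟨ψ₀| - 1` in the initial state. -/
noncomputable def diffusion {n : ℕ} (ψ : QubitSpace n) : QubitSpace n :=
  (2 * inner ℂ (initialState n) ψ) • initialState n - ψ

/-- The state `G^k |ψ₀⟩` after `k` Grover iterations with marked set `S`. -/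
noncomputable def groverState {n : ℕ} (S : Finset (Fin n → Fin 2)) (k : ℕ) : QubitSpace n :=
  (fun ψ => diffusion (oracle S ψ))^[k] (initialState n)

/-- `φ` is fully separable: a tensor product of `n` single-qubit unit vectors. -/
def IsProductState {n : ℕ} (φ : QubitSpace n) : Prop :=
  ∃ v : Fin n → EuclideanSpace ℂ (Fin 2),
    (∀ s, ‖v s‖ = 1) ∧ ∀ x : Fin n → Fin 2, φ x = ∏ s, v s (x s)

/-- The geometric measure of entanglement `1 - max_φ |⟨ψ|φ⟩|²`, over fully separable `φ`. -/
noncomputable def geometricEntanglement {n : ℕ} (ψ : QubitSpace n) : ℝ :=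
  1 - sSup {r : ℝ | ∃ φ : QubitSpace n, IsProductState φ ∧ r = ‖inner ℂ ψ φ‖ ^ 2}

/-- `ψ` is symmetric: invariant under every permutation of the qubits. -/
def IsSymmetricState {n : ℕ} (ψ : QubitSpace n) : Prop :=
  ∀ (σ : Equiv.Perm (Fin n)) (x : Fin n → Fin 2), ψ (fun i => x (σ i)) = ψ x

/-- `θ = arcsin √(M/N)` with `M = |S|` and `N = 2^n`. -/
noncomputable def groverAngle {n : ℕ} (S : Finset (Fin n → Fin 2)) : ℝ :=
  Real.arcsin (Real.sqrt ((S.card : ℝ) / 2 ^ n))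

/-- `θ_k = (2k+1) θ`. -/
noncomputable def iterationAngle {n : ℕ} (S : Finset (Fin n → Fin 2)) (k : ℕ) : ℝ :=
  (2 * (k : ℝ) + 1) * groverAngle S

/-- The optimal number of iterations, the integer closest to `(π/(2θ) - 1)/2`. -/
noncomputable def optimalIterations {n : ℕ} (S : Finset (Fin n → Fin 2)) : ℤ :=
  round ((Real.pi / (2 * groverAngle S) - 1) / 2)

/-- `B(α) = (1/√M) ∑_{x ∈ S} cos^{n-|x|}(α/2) sin^{|x|}(α/2)`: the overlap of the equal
superposition of the marked strings with `(cos(α/2)|0⟩ + sin(α/2)|1⟩)^{⊗n}`. Here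
`hammingNorm x` is the Hamming weight `|x| ≤ n`. -/
noncomputable def markedOverlap {n : ℕ} (S : Finset (Fin n → Fin 2)) (α : ℝ) : ℝ :=
  (1 / Real.sqrt (S.card : ℝ)) *
    ∑ x ∈ S, Real.cos (α / 2) ^ (n - hammingNorm x) * Real.sin (α / 2) ^ hammingNorm x

/-- The turning point `θ_{k_T} = arctan (1 / B_max)`, `B_max = max_{α ∈ [0, π]} B(α)`. -/
noncomputable def turningPoint {n : ℕ} (S : Finset (Fin n → Fin 2)) : ℝ :=
  Real.arctan (1 / sSup (markedOverlap S '' Set.Icc 0 Real.pi))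

/-! Grover's iteration is a rotation in a plane: the state after `k` steps is `sin θ_k |S₁⟩ + cos
θ_k |S₀⟩`, with `S₀` the unmarked strings (`groverState_eq_rotatedState`). When `M/N` is small,
`|S₀⟩` is close to the product state `|ψ₀⟩`.

Let a product state with nonnegative amplitudes have overlap `a` with `|ψ₀⟩` and `b` with `|S₁⟩`.
Two applications of Cauchy–Schwarz and a one-qubit inequality give `a^8 b^4 ≤ M/N`
(`overlapSum_tradeoff`), so `a` and `b` cannot both be large. Since `b ≤ B_max`, every overlap with
the Grover state is at most `max(|cos θ_k|, B_max sin θ_k)` up to a small error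
(`le_of_mem_productOverlaps`). The two terms are nearly attained by `|+⟩^{⊗n}` and by the product
state closest to `|S₁⟩`, and they cross at `tan θ_k = 1/B_max`, the turning point.

That `B_max`, defined with equal real qubits only, bounds `b` for every product state is where
symmetry enters: averaging two qubit angles never lowers the overlap (`overlapSum_le_average`,
`exists_overlapSum_le_const`). Its closed form is the maximum of a binomial weight
(`pow_mul_pow_le_of_add_eq_one`). -/

/-! ### Product vectors with nonnegative amplitudes, and the trade-off between overlaps. -/

/-- The overlap of the unnormalised sum of a set `S` of bit strings with the product vector whose
single-qubit factors have the real amplitudes `u`. -/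
noncomputable def overlapSum {n : ℕ} (S : Finset (Fin n → Fin 2)) (u : Fin n → Fin 2 → ℝ) : ℝ :=
  ∑ x ∈ S, ∏ s, u s (x s)

/-- The amplitudes `(cos t, sin t)` of a single qubit. -/
noncomputable def qubitAmplitude (t : ℝ) : Fin 2 → ℝ := ![Real.cos t, Real.sin t]

lemma continuous_qubitAmplitude (j : Fin 2) : Continuous fun t => qubitAmplitude t j := by
  fin_cases j
  · exact Real.continuous_cos
  · exact Real.continuous_sin

lemma qubitAmplitude_nonneg {t : ℝ} (ht : t ∈ Set.Icc 0 (Real.pi / 2)) (j : Fin 2) :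
    0 ≤ qubitAmplitude t j := by
  have := Real.pi_pos
  fin_cases j
  · exact Real.cos_nonneg_of_mem_Icc ⟨by linarith [ht.1], ht.2⟩
  · exact Real.sin_nonneg_of_nonneg_of_le_pi ht.1 (by linarith [ht.2])

lemma exists_qubitAmplitude {u : Fin 2 → ℝ} (h0 : ∀ j, 0 ≤ u j) (h1 : u 0 ^ 2 + u 1 ^ 2 = 1) :
    ∃ t ∈ Set.Icc 0 (Real.pi / 2), qubitAmplitude t = u := by
  refine ⟨Real.arcsin (u 1), ⟨Real.arcsin_nonneg.2 (h0 1), Real.arcsin_le_pi_div_two _⟩, ?_⟩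
  ext j
  fin_cases j
  · simp only [qubitAmplitude, Real.cos_arcsin, Fin.zero_eta, Matrix.cons_val_zero]
    rw [show 1 - u 1 ^ 2 = u 0 ^ 2 by linarith, Real.sqrt_sq (h0 0)]
  · simp only [qubitAmplitude, Fin.mk_one, Matrix.cons_val_one]
    exact Real.sin_arcsin (by linarith [h0 1]) (by nlinarith [sq_nonneg (u 0)])

lemma overlapSum_nonneg {n : ℕ} (S : Finset (Fin n → Fin 2)) {u : Fin n → Fin 2 → ℝ}
    (h0 : ∀ s j, 0 ≤ u s j) : 0 ≤ overlapSum S u :=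
  Finset.sum_nonneg fun _ _ => Finset.prod_nonneg fun _ _ => h0 _ _

lemma overlapSum_univ {n : ℕ} (u : Fin n → Fin 2 → ℝ) :
    overlapSum Finset.univ u = ∏ s, (u s 0 + u s 1) := by
  unfold overlapSum
  rw [← Fintype.piFinset_univ, ← Finset.prod_univ_sum]
  simp

lemma overlapSum_le_univ {n : ℕ} (S : Finset (Fin n → Fin 2)) {u : Fin n → Fin 2 → ℝ}
    (h0 : ∀ s j, 0 ≤ u s j) : overlapSum S u ≤ overlapSum Finset.univ u :=
  Finset.sum_le_sum_of_subset_of_nonneg (Finset.subset_univ _)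
    fun _ _ _ => Finset.prod_nonneg fun _ _ => h0 _ _

/-- Cauchy–Schwarz over `S`. Squaring the amplitudes gives a vector of the same product form, so the
bound can be iterated. -/
lemma overlapSum_sq_le {n : ℕ} (S : Finset (Fin n → Fin 2)) (u : Fin n → Fin 2 → ℝ) :
    overlapSum S u ^ 2 ≤ S.card * overlapSum S (fun s j => u s j ^ 2) := by
  unfold overlapSum
  simpa only [Finset.prod_pow] using
    sq_sum_le_card_mul_sum_sq (s := S) (f := fun x => ∏ s, u s (x s))

lemma overlapSum_sq_le_card {n : ℕ} (S : Finset (Fin n → Fin 2)) {u : Fin n → Fin 2 → ℝ}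
    (h1 : ∀ s, u s 0 ^ 2 + u s 1 ^ 2 = 1) : overlapSum S u ^ 2 ≤ S.card := by
  refine (overlapSum_sq_le S u).trans ?_
  have h := overlapSum_le_univ S (u := fun s j => u s j ^ 2) fun _ _ => sq_nonneg _
  rw [overlapSum_univ] at h
  simp only [h1, Finset.prod_const_one] at h
  exact mul_le_of_le_one_right (Nat.cast_nonneg _) h

/-- In `z = 2cs` the two factors are `(1 + z)^4` and `1 - z^2/2`. Equality holds at the balanced
qubit `z = 1`, a double root of the difference; the cofactor has positive coefficients. -/
lemma qubit_tradeoff {c s : ℝ} (hc : 0 ≤ c) (hs : 0 ≤ s) (h : c ^ 2 + s ^ 2 = 1) :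
    (c + s) ^ 8 * (c ^ 4 + s ^ 4) ≤ 8 := by
  have hz0 : 0 ≤ 2 * c * s := by positivity
  have hz1 : 2 * c * s ≤ 1 := by nlinarith [sq_nonneg (c - s)]
  obtain ⟨z, hz⟩ : ∃ z, z = 2 * c * s := ⟨_, rfl⟩
  have e1 : (c + s) ^ 8 = (1 + z) ^ 4 := by
    rw [hz, ← h]; ring
  have e2 : c ^ 4 + s ^ 4 = 1 - z ^ 2 / 2 := by
    rw [hz, show (1 : ℝ) = (c ^ 2 + s ^ 2) ^ 2 by rw [h]; ring]; ring
  rw [← hz] at hz0 hz1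
  rw [e1, e2]
  have key : 16 - (1 + z) ^ 4 * (2 - z ^ 2) =
      (1 - z) ^ 2 * (14 + 20 * z + 15 * z ^ 2 + 6 * z ^ 3 + z ^ 4) := by ring
  have : 0 ≤ (1 - z) ^ 2 * (14 + 20 * z + 15 * z ^ 2 + 6 * z ^ 3 + z ^ 4) := by positivity
  linarith

/-- A product vector cannot overlap strongly both with the sum of all strings and with the sum
of the strings in a small set. -/
lemma overlapSum_tradeoff {n : ℕ} (S : Finset (Fin n → Fin 2)) {u : Fin n → Fin 2 → ℝ}
    (h0 : ∀ s j, 0 ≤ u s j) (h1 : ∀ s, u s 0 ^ 2 + u s 1 ^ 2 = 1) :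
    overlapSum Finset.univ u ^ 8 * overlapSum S u ^ 4 ≤ 8 ^ n * (S.card : ℝ) ^ 3 := by
  -- Cauchy–Schwarz twice; the last sum, over `S`, is enlarged to all strings, where it factors over
  -- the qubits.
  have hb : overlapSum S u ^ 4 ≤ (S.card : ℝ) ^ 3 * ∏ s, (u s 0 ^ 4 + u s 1 ^ 4) := by
    have e1 := overlapSum_sq_le S u
    have e2 := overlapSum_sq_le S (fun s j => u s j ^ 2)
    have e3 := overlapSum_le_univ S (u := fun s j => (u s j ^ 2) ^ 2) fun _ _ => sq_nonneg _
    rw [overlapSum_univ] at e3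
    simp only [← pow_mul, Nat.reduceMul] at e2 e3
    calc overlapSum S u ^ 4 = (overlapSum S u ^ 2) ^ 2 := by ring
      _ ≤ (S.card * overlapSum S (fun s j => u s j ^ 2)) ^ 2 := by gcongr
      _ = (S.card : ℝ) ^ 2 * overlapSum S (fun s j => u s j ^ 2) ^ 2 := by ring
      _ ≤ (S.card : ℝ) ^ 2 * (S.card * ∏ s, (u s 0 ^ 4 + u s 1 ^ 4)) := by
          gcongr
          exact e2.trans (by gcongr)
      _ = _ := by ring
  calc overlapSum Finset.univ u ^ 8 * overlapSum S u ^ 4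
      ≤ overlapSum Finset.univ u ^ 8 * ((S.card : ℝ) ^ 3 * ∏ s, (u s 0 ^ 4 + u s 1 ^ 4)) := by
        gcongr
    _ = (S.card : ℝ) ^ 3 * ∏ s, ((u s 0 + u s 1) ^ 8 * (u s 0 ^ 4 + u s 1 ^ 4)) := by
        rw [overlapSum_univ, Finset.prod_mul_distrib, Finset.prod_pow]; ring
    _ ≤ (S.card : ℝ) ^ 3 * ∏ _s : Fin n, (8 : ℝ) := by
        gcongr with s
        exact qubit_tradeoff (h0 s 0) (h0 s 1) (h1 s)
    _ = _ := by simp [mul_comm]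

/-! ### Symmetric sets: equal qubits are optimal. -/

lemma mem_comp_perm_iff {n : ℕ} {S : Finset (Fin n → Fin 2)}
    (hS : IsSymmetricState (uniformState S)) (σ : Equiv.Perm (Fin n)) (x : Fin n → Fin 2) :
    (fun i => x (σ i)) ∈ S ↔ x ∈ S := by
  by_cases hne : S.Nonempty
  · have h : (1 / Real.sqrt (S.card : ℝ) : ℝ) ≠ 0 := by
      have : (0 : ℝ) < S.card := by exact_mod_cast hne.card_pos
      positivity
    have := hS σ x
    simp only [uniformState] at this
    have h' : ((1 / Real.sqrt (S.card : ℝ) : ℝ) : ℂ) ≠ 0 := by exact_mod_cast h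
    split_ifs at this <;> simp_all
  · simp [Finset.not_nonempty_iff_eq_empty.1 hne]

/-- With `t = m + d` and `t' = m - d`, different indices give equality, both sides being `sin (2m)`;
equal indices lose `2 sin² d`. -/
lemma qubitAmplitude_pair_le (t t' : ℝ) (j j' : Fin 2) :
    qubitAmplitude t j * qubitAmplitude t' j' + qubitAmplitude t j' * qubitAmplitude t' j ≤
      2 * (qubitAmplitude ((t + t') / 2) j * qubitAmplitude ((t + t') / 2) j') := by
  obtain ⟨m, d, rfl, rfl⟩ : ∃ m d, t = m + d ∧ t' = m - d :=
    ⟨(t + t') / 2, (t - t') / 2, by ring, by ring⟩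
  have hm : (m + d + (m - d)) / 2 = m := by ring
  have hd := Real.sin_sq_add_cos_sq d
  have hp : Real.sin m * Real.cos m * (Real.sin d ^ 2 + Real.cos d ^ 2) =
      Real.sin m * Real.cos m := by rw [hd, mul_one]
  have hq : Real.cos m ^ 2 * (Real.sin d ^ 2 + Real.cos d ^ 2) = Real.cos m ^ 2 := by
    rw [hd, mul_one]
  have hr : Real.sin m ^ 2 * (Real.sin d ^ 2 + Real.cos d ^ 2) = Real.sin m ^ 2 := by
    rw [hd, mul_one]
  fin_cases j <;> fin_cases j' <;>
    simp only [qubitAmplitude, hm, Real.cos_add, Real.cos_sub, Real.sin_add, Real.sin_sub,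
      Fin.zero_eta, Fin.mk_one, Matrix.cons_val_zero, Matrix.cons_val_one] <;>
    nlinarith [sq_nonneg (Real.cos m * Real.sin d), sq_nonneg (Real.sin m * Real.sin d)]

/-- Replacing two angles by their mean does not decrease the overlap with a symmetric set. -/
lemma overlapSum_le_average {n : ℕ} {S : Finset (Fin n → Fin 2)}
    (hS : IsSymmetricState (uniformState S)) {t : Fin n → ℝ}
    (ht : ∀ s, t s ∈ Set.Icc 0 (Real.pi / 2)) {i j : Fin n} (hij : i ≠ j) :
    overlapSum S (fun s => qubitAmplitude (t s)) ≤ overlapSum S (fun s => qubitAmplitude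
      (if s = i ∨ s = j then (t i + t j) / 2 else t s)) := by
  have split : ∀ f : Fin n → ℝ, ∏ s, f s = f i * f j * ∏ s ∈ (Finset.univ.erase i).erase j, f s := by
    intro f
    rw [← Finset.mul_prod_erase Finset.univ f (Finset.mem_univ i),
      ← Finset.mul_prod_erase (Finset.univ.erase i) f
        (Finset.mem_erase.2 ⟨hij.symm, Finset.mem_univ j⟩), mul_assoc]
  have hR : ∀ x : Fin n → Fin 2,
      0 ≤ ∏ s ∈ (Finset.univ.erase i).erase j, qubitAmplitude (t s) (x s) :=
    fun x => Finset.prod_nonneg fun s _ => qubitAmplitude_nonneg (ht s) _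
  -- Symmetry of `S` allows the qubits `i` and `j` to be exchanged. Adding this form to the direct
  -- one yields the symmetrised pair of `qubitAmplitude_pair_le`.
  have hswap : overlapSum S (fun s => qubitAmplitude (t s)) =
      ∑ x ∈ S, qubitAmplitude (t i) (x j) * qubitAmplitude (t j) (x i) *
        ∏ s ∈ (Finset.univ.erase i).erase j, qubitAmplitude (t s) (x s) := by
    unfold overlapSum
    refine Finset.sum_bij' (fun x _ => fun s => x (Equiv.swap i j s))
      (fun x _ => fun s => x (Equiv.swap i j s)) ?_ ?_ ?_ ?_ ?_
    · exact fun x hx => (mem_comp_perm_iff hS _ x).2 hx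
    · exact fun x hx => (mem_comp_perm_iff hS _ x).2 hx
    · intro x _; simp
    · intro x _; simp
    · intro x _
      rw [split]
      simp only [Equiv.swap_apply_left, Equiv.swap_apply_right]
      congr 1
      refine Finset.prod_congr rfl fun s hs => ?_
      simp only [Finset.mem_erase] at hs
      rw [Equiv.swap_apply_of_ne_of_ne hs.2.1 hs.1]
  have hdir : overlapSum S (fun s => qubitAmplitude (t s)) =
      ∑ x ∈ S, qubitAmplitude (t i) (x i) * qubitAmplitude (t j) (x j) *
        ∏ s ∈ (Finset.univ.erase i).erase j, qubitAmplitude (t s) (x s) :=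
    Finset.sum_congr rfl fun x _ => split _
  have havg : overlapSum S (fun s => qubitAmplitude
      (if s = i ∨ s = j then (t i + t j) / 2 else t s)) =
      ∑ x ∈ S, qubitAmplitude ((t i + t j) / 2) (x i) * qubitAmplitude ((t i + t j) / 2) (x j) *
        ∏ s ∈ (Finset.univ.erase i).erase j, qubitAmplitude (t s) (x s) := by
    refine Finset.sum_congr rfl fun x _ => ?_
    rw [split]
    simp only [true_or, or_true, if_true]
    congr 1
    refine Finset.prod_congr rfl fun s hs => ?_
    simp only [Finset.mem_erase] at hs
    rw [if_neg (by tauto)]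
  have : 2 * overlapSum S (fun s => qubitAmplitude (t s)) ≤ 2 * overlapSum S (fun s =>
      qubitAmplitude (if s = i ∨ s = j then (t i + t j) / 2 else t s)) := by
    rw [two_mul]
    nth_rewrite 1 [hdir]
    rw [hswap, havg, ← Finset.sum_add_distrib, Finset.mul_sum]
    refine Finset.sum_le_sum fun x _ => ?_
    rw [← add_mul, ← mul_assoc]
    exact mul_le_mul_of_nonneg_right (qubitAmplitude_pair_le _ _ _ _) (hR x)
  linarith

/-- The product vector closest to a symmetric set of strings can be taken symmetric. -/
lemma exists_overlapSum_le_const {n : ℕ} {S : Finset (Fin n → Fin 2)}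
    (hS : IsSymmetricState (uniformState S)) {t : Fin n → ℝ}
    (ht : ∀ s, t s ∈ Set.Icc 0 (Real.pi / 2)) :
    ∃ r ∈ Set.Icc 0 (Real.pi / 2), overlapSum S (fun s => qubitAmplitude (t s)) ≤
      overlapSum S (fun _ => qubitAmplitude r) := by
  have hcont : Continuous fun r : Fin n → ℝ => overlapSum S (fun s => qubitAmplitude (r s)) := by
    unfold overlapSum
    exact continuous_finsetSum _ fun x _ => continuous_finsetProd _ fun s _ =>
      (continuous_qubitAmplitude _).comp (continuous_apply s)
  have hK : IsCompact (Set.univ.pi (fun _ : Fin n => Set.Icc (0 : ℝ) (Real.pi / 2)) ∩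
      {r | overlapSum S (fun s => qubitAmplitude (t s)) ≤
        overlapSum S (fun s => qubitAmplitude (r s))}) :=
    (isCompact_univ_pi fun _ => isCompact_Icc).inter_right
      (isClosed_le continuous_const hcont)
  -- Among the angle vectors with at least the given overlap, one of least `∑ r_s²` is chosen.
  -- Averaging two unequal angles would stay in this set and lower the sum by `(r_i - r_j)²/2`, so
  -- all angles agree.
  obtain ⟨r, ⟨hr, hrt⟩, hmin⟩ := hK.exists_isMinOn ⟨t, fun s _ => ht s, le_refl (overlapSum S _)⟩
    (f := fun r => ∑ s, r s ^ 2) (by fun_prop)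
  simp only [Set.mem_pi, Set.mem_univ, true_imp_iff, Set.mem_ofPred_eq] at hr hrt
  have hconst : ∀ i j, r i = r j := by
    intro i j
    by_contra hne
    have hij : i ≠ j := fun h => hne (by rw [h])
    have hmem := hmin (a := fun s => if s = i ∨ s = j then (r i + r j) / 2 else r s)
      ⟨fun s _ => by
        dsimp only
        split_ifs
        · exact ⟨by linarith [(hr i).1, (hr j).1], by linarith [(hr i).2, (hr j).2]⟩
        · exact hr s, hrt.trans (overlapSum_le_average hS hr hij)⟩
    simp only [Set.mem_ofPred_eq] at hmem
    have split : ∀ f : Fin n → ℝ, ∑ s, f s = f i + (f j + ∑ s ∈ (Finset.univ.erase i).erase j, f s) := by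
      intro f
      rw [← Finset.add_sum_erase Finset.univ f (Finset.mem_univ i),
        ← Finset.add_sum_erase (Finset.univ.erase i) f
          (Finset.mem_erase.2 ⟨hij.symm, Finset.mem_univ j⟩)]
    rw [split, split] at hmem
    have hrest : ∑ s ∈ (Finset.univ.erase i).erase j,
        (if s = i ∨ s = j then (r i + r j) / 2 else r s) ^ 2 =
        ∑ s ∈ (Finset.univ.erase i).erase j, r s ^ 2 := by
      refine Finset.sum_congr rfl fun s hs => ?_
      simp only [Finset.mem_erase] at hs
      rw [if_neg (by tauto)]
    rw [hrest] at hmem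
    simp only [true_or, or_true, if_true] at hmem
    have : 0 < (r i - r j) ^ 2 := by
      have := sub_ne_zero.2 hne
      positivity
    nlinarith
  rcases Nat.eq_zero_or_pos n with rfl | hn
  · refine ⟨0, ⟨le_refl _, by positivity⟩, le_of_eq ?_⟩
    exact congrArg _ (Subsingleton.elim _ _)
  · refine ⟨r ⟨0, hn⟩, hr _, hrt.trans (le_of_eq ?_)⟩
    exact congrArg _ (funext fun s => by rw [hconst s ⟨0, hn⟩])

/-! ### The value of `B_max` and the turning point. -/

lemma hammingNorm_le {n : ℕ} (x : Fin n → Fin 2) : hammingNorm x ≤ n := by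
  simpa using hammingNorm_le_card_fintype (x := x)

lemma prod_qubitAmplitude {n : ℕ} (r : ℝ) (x : Fin n → Fin 2) :
    ∏ s, qubitAmplitude r (x s) =
      Real.cos r ^ (n - hammingNorm x) * Real.sin r ^ hammingNorm x := by
  have h : ∀ j : Fin 2, qubitAmplitude r j = if j ≠ 0 then Real.sin r else Real.cos r := by
    intro j; fin_cases j <;> simp [qubitAmplitude]
  have hcard := Finset.card_filter_add_card_filter_not (s := Finset.univ) (fun s => x s ≠ 0)
  simp only [Finset.card_univ, Fintype.card_fin] at hcard
  simp only [h, Finset.prod_ite, Finset.prod_const]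
  rw [mul_comm, hammingNorm, ← Nat.sub_eq_of_eq_add' hcard.symm]

lemma markedOverlap_eq_overlapSum {n : ℕ} (S : Finset (Fin n → Fin 2)) (α : ℝ) :
    markedOverlap S α =
      1 / Real.sqrt (S.card : ℝ) * overlapSum S (fun _ => qubitAmplitude (α / 2)) := by
  simp only [markedOverlap, overlapSum, prod_qubitAmplitude]

lemma markedOverlap_eq {n w : ℕ} {S : Finset (Fin n → Fin 2)}
    (hw : ∀ x ∈ S, hammingNorm x = w) (α : ℝ) :
    markedOverlap S α =
      Real.sqrt (S.card : ℝ) * (Real.cos (α / 2) ^ (n - w) * Real.sin (α / 2) ^ w) := by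
  unfold markedOverlap
  rw [Finset.sum_congr rfl fun x hx => by rw [hw x hx], Finset.sum_const, nsmul_eq_mul,
    ← mul_assoc, one_div_mul_eq_div, Real.div_sqrt]

/-- The maximum of `q ^ w * (1 - q) ^ v` over `q ∈ [0, 1]` is attained at `w / (w + v)`. -/
lemma pow_mul_pow_le_of_add_eq_one {v w : ℕ} {a b : ℝ} (ha : 0 ≤ a) (hb : 0 ≤ b)
    (hab : a + b = 1) (hn : 0 < v + w) :
    a ^ v * b ^ w ≤ ((v : ℝ) / (v + w)) ^ v * ((w : ℝ) / (v + w)) ^ w := by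
  have hn' : (0 : ℝ) < v + w := by exact_mod_cast hn
  -- This is `y ≤ exp (y - 1)` at `y = (v + w) x / m`, raised to the power `m`. For `a + b = 1` the
  -- exponents of the two factors cancel.
  have key : ∀ (m : ℕ) (x : ℝ), 0 ≤ x →
      x ^ m ≤ ((m : ℝ) / (v + w)) ^ m * Real.exp ((v + w) * x - m) := by
    intro m x hx
    rcases Nat.eq_zero_or_pos m with rfl | hm
    · simpa using mul_nonneg hn'.le hx
    · have hm' : (0 : ℝ) < m := by exact_mod_cast hm
      have h1 : x ≤ (m : ℝ) / (v + w) * Real.exp ((v + w) * x / m - 1) := by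
        have := Real.add_one_le_exp ((v + w) * x / m - 1)
        calc x = (m : ℝ) / (v + w) * ((v + w) * x / m - 1 + 1) := by field_simp; ring
          _ ≤ _ := by gcongr
      calc x ^ m ≤ ((m : ℝ) / (v + w) * Real.exp ((v + w) * x / m - 1)) ^ m := by gcongr
        _ = _ := by
          rw [mul_pow, ← Real.exp_nat_mul]
          congr 2
          field_simp
  calc a ^ v * b ^ w
      ≤ (((v : ℝ) / (v + w)) ^ v * Real.exp ((v + w) * a - v)) *
        (((w : ℝ) / (v + w)) ^ w * Real.exp ((v + w) * b - w)) :=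
        mul_le_mul (key v a ha) (key w b hb) (by positivity) (by positivity)
    _ = ((v : ℝ) / (v + w)) ^ v * ((w : ℝ) / (v + w)) ^ w *
        Real.exp (((v : ℝ) + w) * (a + b) - v - w) := by
        rw [mul_mul_mul_comm, ← Real.exp_add]; ring_nf
    _ = _ := by rw [hab]; ring_nf; simp

lemma markedOverlap_isGreatest {n w : ℕ} {S : Finset (Fin n → Fin 2)} (hn : 0 < n)
    (hwn : w ≤ n) (hw : ∀ x ∈ S, hammingNorm x = w) :
    IsGreatest (markedOverlap S '' Set.Icc 0 Real.pi)
      (Real.sqrt ((S.card : ℝ) * (1 - (w : ℝ) / n) ^ (n - w) * ((w : ℝ) / n) ^ w)) := by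
  have hn' : (0 : ℝ) < n := by exact_mod_cast hn
  have hw' : (w : ℝ) ≤ n := by exact_mod_cast hwn
  have hp0 : (0 : ℝ) ≤ (w : ℝ) / n := by positivity
  have hp1 : (w : ℝ) / n ≤ 1 := (div_le_one hn').2 hw'
  constructor
  -- The maximiser has `sin² (α/2) = w/n`.
  · refine ⟨2 * Real.arcsin (Real.sqrt ((w : ℝ) / n)), ⟨?_, ?_⟩, ?_⟩
    · have := Real.arcsin_nonneg.2 (Real.sqrt_nonneg ((w : ℝ) / n))
      positivity
    · linarith [Real.arcsin_le_pi_div_two (Real.sqrt ((w : ℝ) / n))]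
    · rw [markedOverlap_eq hw, mul_div_cancel_left₀ _ two_ne_zero, Real.cos_arcsin,
        Real.sq_sqrt hp0, Real.sin_arcsin (by linarith [Real.sqrt_nonneg ((w : ℝ) / n)])
          (Real.sqrt_le_one.2 hp1),
        mul_assoc, Real.sqrt_mul (Nat.cast_nonneg _),
        Real.sqrt_mul (pow_nonneg (sub_nonneg.2 hp1) _)]
      congr 2
      · exact (Real.sqrt_eq_iff_mul_self_eq (by positivity) (by positivity)).2 (by
          rw [← mul_pow, Real.mul_self_sqrt (sub_nonneg.2 hp1)]) |>.symm
      · exact (Real.sqrt_eq_iff_mul_self_eq (by positivity) (by positivity)).2 (by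
          rw [← mul_pow, Real.mul_self_sqrt hp0]) |>.symm
  · rintro _ ⟨α, -, rfl⟩
    rw [markedOverlap_eq hw]
    refine Real.le_sqrt_of_sq_le ?_
    have h := pow_mul_pow_le_of_add_eq_one (v := n - w) (w := w)
      (sq_nonneg (Real.cos (α / 2))) (sq_nonneg (Real.sin (α / 2)))
      (by rw [add_comm]; exact Real.sin_sq_add_cos_sq _) (by omega)
    rw [Nat.cast_sub hwn, sub_add_cancel, sub_div, div_self hn'.ne'] at h
    calc (Real.sqrt (S.card : ℝ) * (Real.cos (α / 2) ^ (n - w) * Real.sin (α / 2) ^ w)) ^ 2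
        = (S.card : ℝ) * ((Real.cos (α / 2) ^ 2) ^ (n - w) * (Real.sin (α / 2) ^ 2) ^ w) := by
          rw [mul_pow, Real.sq_sqrt (Nat.cast_nonneg _)]; ring
      _ ≤ _ := by rw [mul_assoc]; gcongr

lemma rpow_neg_half_eq {x : ℝ} (hx : 0 ≤ x) (m : ℕ) :
    x ^ (-(m : ℝ) / 2) = (Real.sqrt (x ^ m))⁻¹ := by
  rw [neg_div, Real.rpow_neg hx, Real.sqrt_eq_rpow, ← Real.rpow_natCast, ← Real.rpow_mul hx]
  ring_nf

lemma turningPoint_eq {n w : ℕ} {S : Finset (Fin n → Fin 2)} (hn : 0 < n)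
    (hwn : w ≤ n) (hw : ∀ x ∈ S, hammingNorm x = w) :
    turningPoint S = Real.arctan
      ((1 - (w : ℝ) / n) ^ (((w : ℝ) - n) / 2) * ((w : ℝ) / n) ^ (-(w : ℝ) / 2)
        / Real.sqrt (S.card : ℝ)) := by
  have hn' : (0 : ℝ) < n := by exact_mod_cast hn
  have hw' : (w : ℝ) ≤ n := by exact_mod_cast hwn
  have hp0 : (0 : ℝ) ≤ (w : ℝ) / n := by positivity
  have hp1 : 0 ≤ 1 - (w : ℝ) / n := sub_nonneg.2 ((div_le_one hn').2 hw')
  rw [turningPoint, (markedOverlap_isGreatest hn hwn hw).csSup_eq, rpow_neg_half_eq hp0,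
    show (w : ℝ) - n = -((n - w : ℕ) : ℝ) by rw [Nat.cast_sub hwn]; ring, rpow_neg_half_eq hp1,
    mul_assoc, Real.sqrt_mul (Nat.cast_nonneg _), Real.sqrt_mul (by positivity)]
  congr 1
  rw [one_div, mul_inv, mul_inv, mul_comm]
  exact (div_eq_mul_inv _ _).symm

/-- The overlap of a symmetric set of marked strings with a real product state is at most
`B_max`. -/
lemma overlapSum_le_of_isGreatest {n : ℕ} {S : Finset (Fin n → Fin 2)} {B : ℝ}
    (hne : S.Nonempty) (hS : IsSymmetricState (uniformState S))
    (hB : IsGreatest (markedOverlap S '' Set.Icc 0 Real.pi) B) {u : Fin n → Fin 2 → ℝ}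
    (h0 : ∀ s j, 0 ≤ u s j) (h1 : ∀ s, u s 0 ^ 2 + u s 1 ^ 2 = 1) :
    overlapSum S u ≤ Real.sqrt S.card * B := by
  choose t ht htu using fun s => exists_qubitAmplitude (h0 s) (h1 s)
  obtain ⟨r, hr, hle⟩ := exists_overlapSum_le_const hS ht
  simp only [htu] at hle
  refine hle.trans ?_
  have hM : 0 < Real.sqrt (S.card : ℝ) := Real.sqrt_pos.2 (by exact_mod_cast hne.card_pos)
  have h := hB.2 ⟨2 * r, ⟨by linarith [hr.1], by linarith [hr.2]⟩, rfl⟩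
  rw [markedOverlap_eq_overlapSum, mul_div_cancel_left₀ _ two_ne_zero, one_div_mul_eq_div,
    div_le_iff₀ hM] at h
  linarith

lemma exists_overlapSum_eq_of_isGreatest {n : ℕ} {S : Finset (Fin n → Fin 2)} {B : ℝ}
    (hne : S.Nonempty) (hB : IsGreatest (markedOverlap S '' Set.Icc 0 Real.pi) B) :
    ∃ u : Fin n → Fin 2 → ℝ, (∀ s j, 0 ≤ u s j) ∧ (∀ s, u s 0 ^ 2 + u s 1 ^ 2 = 1) ∧
      overlapSum S u = Real.sqrt S.card * B := by
  obtain ⟨α, hα, rfl⟩ := hB.1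
  have hM : 0 < Real.sqrt (S.card : ℝ) := Real.sqrt_pos.2 (by exact_mod_cast hne.card_pos)
  refine ⟨fun _ => qubitAmplitude (α / 2), fun _ => qubitAmplitude_nonneg
    ⟨by linarith [hα.1], by linarith [hα.2]⟩, fun _ => ?_, ?_⟩
  · simp [qubitAmplitude]
  · rw [markedOverlap_eq_overlapSum]
    field_simp

lemma overlapMax_mem_Ioc {n w : ℕ} {S : Finset (Fin n → Fin 2)} {B : ℝ} (hne : S.Nonempty)
    (hn : 0 < n) (hwn : w ≤ n)
    (hB : IsGreatest (markedOverlap S '' Set.Icc 0 Real.pi) B)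
    (hBw : B = Real.sqrt ((S.card : ℝ) * (1 - (w : ℝ) / n) ^ (n - w) * ((w : ℝ) / n) ^ w)) :
    B ∈ Set.Ioc 0 1 := by
  have hM : (0 : ℝ) < S.card := by exact_mod_cast hne.card_pos
  constructor
  · rw [hBw, Real.sqrt_pos]
    have hn' : (0 : ℝ) < n := by exact_mod_cast hn
    -- At `w = n`, and for the next factor at `w = 0`, positivity rests on `0 ^ 0 = 1`.
    have h1 : 0 < (1 - (w : ℝ) / n) ^ (n - w) := by
      rcases hwn.eq_or_lt with rfl | hlt
      · simp
      · have : (w : ℝ) / n < 1 := (div_lt_one hn').2 (by exact_mod_cast hlt)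
        exact pow_pos (by linarith) _
    have h2 : 0 < ((w : ℝ) / n) ^ w := by
      rcases Nat.eq_zero_or_pos w with rfl | hw
      · simp
      · positivity
    positivity
  · obtain ⟨u, -, h1, hu⟩ := exists_overlapSum_eq_of_isGreatest hne hB
    have h := overlapSum_sq_le_card S h1
    rw [hu, mul_pow, Real.sq_sqrt hM.le] at h
    have : B ^ 2 ≤ 1 := by nlinarith
    nlinarith

/-! ### Grover's iteration as a rotation. -/

lemma iterationAngle_succ {n : ℕ} (S : Finset (Fin n → Fin 2)) (k : ℕ) :
    iterationAngle S (k + 1) = iterationAngle S k + 2 * groverAngle S := by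
  simp only [iterationAngle]; push_cast; ring

lemma card_div_le_one {n : ℕ} (S : Finset (Fin n → Fin 2)) : (S.card : ℝ) / 2 ^ n ≤ 1 := by
  rw [div_le_one (by positivity)]
  have := S.card_le_univ
  simp only [Fintype.card_fun, Fintype.card_fin] at this
  exact_mod_cast this

lemma sin_groverAngle {n : ℕ} (S : Finset (Fin n → Fin 2)) :
    Real.sin (groverAngle S) = Real.sqrt ((S.card : ℝ) / 2 ^ n) :=
  Real.sin_arcsin (by linarith [Real.sqrt_nonneg ((S.card : ℝ) / 2 ^ n)])
    (Real.sqrt_le_one.2 (card_div_le_one S))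

lemma cos_groverAngle {n : ℕ} (S : Finset (Fin n → Fin 2)) :
    Real.cos (groverAngle S) = Real.sqrt ((2 ^ n - S.card) / 2 ^ n) := by
  rw [groverAngle, Real.cos_arcsin, Real.sq_sqrt (by positivity), sub_div, div_self (by positivity)]

/-- The state `sin t |S₁⟩ + cos t |S₀⟩`, with `S₀` the complement of `S = S₁`. -/
noncomputable def rotatedState {n : ℕ} (S : Finset (Fin n → Fin 2)) (t : ℝ) : QubitSpace n :=
  WithLp.toLp 2 (fun x => if x ∈ S then ((Real.sin t / Real.sqrt S.card : ℝ) : ℂ)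
    else ((Real.cos t / Real.sqrt (2 ^ n - S.card) : ℝ) : ℂ))

lemma initialState_apply {n : ℕ} (x : Fin n → Fin 2) :
    initialState n x = ((1 / Real.sqrt (2 ^ n) : ℝ) : ℂ) := by
  simp [initialState, uniformState]

lemma card_compl_cast {n : ℕ} (S : Finset (Fin n → Fin 2)) :
    ((Sᶜ.card : ℕ) : ℝ) = 2 ^ n - S.card := by
  rw [Finset.card_compl, Nat.cast_sub S.card_le_univ]
  simp

lemma initialState_eq_rotatedState {n : ℕ} {S : Finset (Fin n → Fin 2)} (hne : S.Nonempty)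
    (hlt : (S.card : ℝ) < 2 ^ n) : initialState n = rotatedState S (groverAngle S) := by
  have hM : 0 < Real.sqrt (S.card : ℝ) := Real.sqrt_pos.2 (by exact_mod_cast hne.card_pos)
  have hN : 0 < Real.sqrt ((2 : ℝ) ^ n - S.card) := Real.sqrt_pos.2 (sub_pos.2 hlt)
  ext x
  rw [initialState_apply]
  simp only [rotatedState, sin_groverAngle, cos_groverAngle,
    Real.sqrt_div (Nat.cast_nonneg _), Real.sqrt_div (sub_nonneg.2 hlt.le)]
  split_ifs <;> congr 1 <;> field_simp

/-- A product of two reflections: the oracle sends the angle `t` to `-t`, and the reflection in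
`|ψ₀⟩`, which sits at angle `θ`, sends `-t` to `t + 2θ`. Unmarked strings must exist for `|S₀⟩` to
be normalisable. -/
lemma diffusion_oracle_rotatedState {n : ℕ} {S : Finset (Fin n → Fin 2)} (hne : S.Nonempty)
    (hlt : (S.card : ℝ) < 2 ^ n) (t : ℝ) :
    diffusion (oracle S (rotatedState S t)) = rotatedState S (t + 2 * groverAngle S) := by
  have hM' : (0 : ℝ) < S.card := by exact_mod_cast hne.card_pos
  have hM : 0 < Real.sqrt (S.card : ℝ) := Real.sqrt_pos.2 hM'
  have hL : 0 < Real.sqrt ((2 : ℝ) ^ n - S.card) := Real.sqrt_pos.2 (sub_pos.2 hlt)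
  have hN : 0 < Real.sqrt ((2 : ℝ) ^ n) := Real.sqrt_pos.2 (by positivity)
  have hsin : Real.sin (groverAngle S) = Real.sqrt S.card / Real.sqrt (2 ^ n) := by
    rw [sin_groverAngle, Real.sqrt_div (Nat.cast_nonneg _)]
  have hcos : Real.cos (groverAngle S) = Real.sqrt (2 ^ n - S.card) / Real.sqrt (2 ^ n) := by
    rw [cos_groverAngle, Real.sqrt_div (sub_nonneg.2 hlt.le)]
  have hinner : inner ℂ (initialState n) (oracle S (rotatedState S t)) =
      ((Real.cos (t + groverAngle S) : ℝ) : ℂ) := by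
    have hterm : ∀ x, inner ℂ (initialState n x) (oracle S (rotatedState S t) x) =
        (((if x ∈ S then -(Real.sin t / Real.sqrt S.card) else
          Real.cos t / Real.sqrt (2 ^ n - S.card)) * (1 / Real.sqrt (2 ^ n)) : ℝ) : ℂ) := by
      intro x
      rw [initialState_apply]
      simp only [oracle, rotatedState, RCLike.inner_apply, Complex.conj_ofReal]
      split_ifs <;> push_cast <;> ring
    rw [PiLp.inner_apply, Finset.sum_congr rfl fun x _ => hterm x, ← Complex.ofReal_sum,
      ← Finset.sum_mul, Finset.sum_ite]
    congr 1
    have e1 : Finset.univ.filter (fun x => x ∈ S) = S := by ext; simp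
    have e2 : Finset.univ.filter (fun x => x ∉ S) = Sᶜ := by ext; simp
    rw [e1, e2, Finset.sum_const, Finset.sum_const, nsmul_eq_mul, nsmul_eq_mul, card_compl_cast,
      Real.cos_add, hsin, hcos]
    have q1 := Real.mul_self_sqrt hM'.le
    have q2 := Real.mul_self_sqrt (sub_pos.2 hlt).le
    nth_rewrite 1 [← q1]
    nth_rewrite 1 [← q2]
    field_simp
    ring
  have ht : t + 2 * groverAngle S = (t + groverAngle S) + groverAngle S := by ring
  ext x
  simp only [diffusion, hinner, PiLp.sub_apply, PiLp.smul_apply, smul_eq_mul, initialState_apply]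
  have hsub : t = (t + groverAngle S) - groverAngle S := by ring
  rw [ht]
  simp only [oracle, rotatedState]
  split_ifs
  · have e : Real.sin (t + groverAngle S + groverAngle S) =
        2 * Real.cos (t + groverAngle S) * Real.sin (groverAngle S) + Real.sin t := by
      nth_rewrite 3 [hsub]
      rw [Real.sin_add (t + _), Real.sin_sub]; ring
    have key : ∀ a b c d : ℝ, 0 < c → 0 < d →
        (2 * a * (c / d) + b) / c = 2 * a * (1 / d) + b / c := by
      intro a b c d hc hd
      field_simp
    rw [e, hsin, key _ _ _ _ hM hN]
    push_cast
    ring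
  · have e : Real.cos (t + groverAngle S + groverAngle S) =
        2 * Real.cos (t + groverAngle S) * Real.cos (groverAngle S) - Real.cos t := by
      nth_rewrite 3 [hsub]
      rw [Real.cos_add (t + _), Real.cos_sub]; ring
    have key : ∀ a b c d : ℝ, 0 < c → 0 < d →
        (2 * a * (c / d) - b) / c = 2 * a * (1 / d) - b / c := by
      intro a b c d hc hd
      field_simp
    rw [e, hcos, key _ _ _ _ hL hN]
    push_cast
    ring

lemma groverState_eq_rotatedState {n : ℕ} {S : Finset (Fin n → Fin 2)} (hne : S.Nonempty)
    (hlt : (S.card : ℝ) < 2 ^ n) (k : ℕ) :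
    groverState S k = rotatedState S (iterationAngle S k) := by
  induction k with
  | zero => simpa [groverState, iterationAngle] using initialState_eq_rotatedState hne hlt
  | succ k ih =>
    rw [groverState, Function.iterate_succ_apply', ← groverState, ih,
      diffusion_oracle_rotatedState hne hlt, iterationAngle_succ]

/-! ### Overlaps of rotated states with product states. -/

lemma overlapSum_compl {n : ℕ} (S : Finset (Fin n → Fin 2)) (u : Fin n → Fin 2 → ℝ) :
    overlapSum S u + overlapSum Sᶜ u = overlapSum Finset.univ u :=
  Finset.sum_add_sum_compl S _

/-- The modulus of the overlap with a product state is at most the overlap of the moduli. -/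
lemma norm_inner_rotatedState_le {n : ℕ} (S : Finset (Fin n → Fin 2)) (t : ℝ) {φ : QubitSpace n}
    (hφ : IsProductState φ) :
    ∃ u : Fin n → Fin 2 → ℝ, (∀ s j, 0 ≤ u s j) ∧ (∀ s, u s 0 ^ 2 + u s 1 ^ 2 = 1) ∧
      ‖inner ℂ (rotatedState S t) φ‖ ≤ |Real.sin t| * (overlapSum S u / Real.sqrt S.card) +
        |Real.cos t| * (overlapSum Sᶜ u / Real.sqrt (2 ^ n - S.card)) := by
  obtain ⟨v, hv, hφ⟩ := hφ
  refine ⟨fun s j => ‖v s j‖, fun _ _ => norm_nonneg _, fun s => ?_, ?_⟩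
  · have := EuclideanSpace.norm_sq_eq (v s)
    rw [hv s, Fin.sum_univ_two] at this
    linarith
  · rw [PiLp.inner_apply]
    refine (norm_sum_le _ _).trans (le_of_eq ?_)
    rw [← Finset.sum_add_sum_compl S]
    unfold overlapSum
    rw [Finset.sum_div, Finset.sum_div, Finset.mul_sum, Finset.mul_sum]
    congr 1
    · refine Finset.sum_congr rfl fun x hx => ?_
      simp only [rotatedState, if_pos hx, RCLike.inner_apply, Complex.conj_ofReal, norm_mul, hφ,
        norm_prod, Complex.norm_real, Real.norm_eq_abs, abs_div, abs_of_nonneg (Real.sqrt_nonneg _)]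
      ring
    · refine Finset.sum_congr rfl fun x hx => ?_
      simp only [rotatedState, if_neg (Finset.mem_compl.1 hx), RCLike.inner_apply,
        Complex.conj_ofReal, norm_mul, hφ,
        norm_prod, Complex.norm_real, Real.norm_eq_abs, abs_div, abs_of_nonneg (Real.sqrt_nonneg _)]
      ring

lemma exists_isProductState_inner {n : ℕ} (S : Finset (Fin n → Fin 2)) (t : ℝ)
    {u : Fin n → Fin 2 → ℝ} (h1 : ∀ s, u s 0 ^ 2 + u s 1 ^ 2 = 1) :
    ∃ φ : QubitSpace n, IsProductState φ ∧ ‖inner ℂ (rotatedState S t) φ‖ ^ 2 =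
      (Real.sin t * (overlapSum S u / Real.sqrt S.card) +
        Real.cos t * (overlapSum Sᶜ u / Real.sqrt (2 ^ n - S.card))) ^ 2 := by
  refine ⟨WithLp.toLp 2 fun x => ((∏ s, u s (x s) : ℝ) : ℂ),
    ⟨fun s => WithLp.toLp 2 fun j => (u s j : ℂ), fun s => ?_, fun x => by simp⟩, ?_⟩
  · rw [EuclideanSpace.norm_eq, Fin.sum_univ_two]
    simp [h1 s]
  · have : inner ℂ (rotatedState S t) (WithLp.toLp 2 fun x => ((∏ s, u s (x s) : ℝ) : ℂ)) =
        ((Real.sin t * (overlapSum S u / Real.sqrt S.card) +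
        Real.cos t * (overlapSum Sᶜ u / Real.sqrt (2 ^ n - S.card)) : ℝ) : ℂ) := by
      rw [PiLp.inner_apply, ← Finset.sum_add_sum_compl S]
      unfold overlapSum
      rw [Finset.sum_div, Finset.sum_div, Finset.mul_sum, Finset.mul_sum, Complex.ofReal_add,
        Complex.ofReal_sum, Complex.ofReal_sum]
      congr 1
      · refine Finset.sum_congr rfl fun x hx => ?_
        simp only [rotatedState, if_pos hx, RCLike.inner_apply, Complex.conj_ofReal]
        rw [← Complex.ofReal_mul]
        congr 1
        ring
      · refine Finset.sum_congr rfl fun x hx => ?_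
        simp only [rotatedState, if_neg (Finset.mem_compl.1 hx), RCLike.inner_apply,
          Complex.conj_ofReal]
        rw [← Complex.ofReal_mul]
        congr 1
        ring
    rw [this, Complex.norm_real, Real.norm_eq_abs, sq_abs]

/-- The squared overlaps of `ψ` with the product states. -/
def productOverlaps {n : ℕ} (ψ : QubitSpace n) : Set ℝ :=
  {r : ℝ | ∃ φ : QubitSpace n, IsProductState φ ∧ r = ‖inner ℂ ψ φ‖ ^ 2}

lemma sqrt_two_pow_sub_card {n : ℕ} (S : Finset (Fin n → Fin 2)) :
    Real.sqrt (2 ^ n - S.card) = Real.sqrt (2 ^ n) * Real.sqrt (1 - S.card / 2 ^ n) := by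
  rw [← Real.sqrt_mul (by positivity), mul_sub, mul_one, mul_div_cancel₀ _ (by positivity)]

/-- If both `a` and `b` exceeded `δ`, then `a^8 b^4 > δ^12`. So one of the two terms is at most `δ`,
and the other is bounded by its entry of the maximum. -/
lemma mul_add_mul_le_max_add {a b B c s δ : ℝ} (ha : 0 ≤ a) (ha1 : a ≤ 1) (hb : 0 ≤ b)
    (hbB : b ≤ B) (hc : 0 ≤ c) (hc1 : c ≤ 1) (hs : 0 ≤ s) (hs1 : s ≤ 1) (hδ : 0 ≤ δ)
    (hab : a ^ 8 * b ^ 4 ≤ δ ^ 12) : s * b + c * a ≤ max c (s * B) + δ := by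
  have h : a ≤ δ ∨ b ≤ δ := by
    by_contra! hcon
    have h8 : δ ^ 8 < a ^ 8 := pow_lt_pow_left₀ hcon.1 hδ (by norm_num)
    have h4 : δ ^ 4 < b ^ 4 := pow_lt_pow_left₀ hcon.2 hδ (by norm_num)
    have := mul_lt_mul'' h8 h4 (by positivity) (by positivity)
    linarith [show δ ^ 8 * δ ^ 4 = δ ^ 12 by ring]
  rcases h with h | h
  · have := mul_le_mul_of_nonneg_left hbB hs
    have := mul_le_mul hc1 h ha zero_le_one
    linarith [le_max_right c (s * B)]
  · have := mul_le_mul hs1 h hb zero_le_one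
    have := mul_le_of_le_one_right hc ha1
    linarith [le_max_left c (s * B)]

lemma sq_div_one_sub_le {m δ η : ℝ} (hm : 0 ≤ m) (hm1 : m ≤ 1) (hδ : 0 ≤ δ) (hδ1 : δ ≤ 1 / 2)
    (hη : 0 ≤ η) (hηδ : η ≤ δ) : (m + δ) ^ 2 / (1 - η) ≤ m ^ 2 + 12 * δ := by
  rw [div_le_iff₀ (by linarith)]
  have h1 : m * δ ≤ δ := mul_le_of_le_one_left hδ hm1
  have h2 : δ * δ ≤ 1 / 2 * δ := by gcongr
  have h3 : (m ^ 2 + 12 * δ) * η ≤ (1 + 6) * δ := by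
    have : m ^ 2 ≤ 1 := pow_le_one₀ hm hm1
    gcongr
    linarith
  nlinarith

lemma le_of_mem_productOverlaps {n : ℕ} {S : Finset (Fin n → Fin 2)} {B δ t : ℝ}
    (hne : S.Nonempty) (hS : IsSymmetricState (uniformState S))
    (hB : IsGreatest (markedOverlap S '' Set.Icc 0 Real.pi) B) (hB1 : B ≤ 1)
    (hδ : 0 ≤ δ) (hδ1 : δ ≤ 1 / 2) (hη : (S.card : ℝ) / 2 ^ n ≤ δ ^ 12)
    (ht : 0 ≤ Real.sin t) {r : ℝ} (hr : r ∈ productOverlaps (rotatedState S t)) :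
    r ≤ max |Real.cos t| (Real.sin t * B) ^ 2 + 12 * δ := by
  obtain ⟨φ, hφ, rfl⟩ := hr
  obtain ⟨u, h0, h1, hle⟩ := norm_inner_rotatedState_le S t hφ
  have hM : (0 : ℝ) < S.card := by exact_mod_cast hne.card_pos
  have hsM : 0 < Real.sqrt (S.card : ℝ) := Real.sqrt_pos.2 hM
  have hN : (0 : ℝ) < 2 ^ n := by positivity
  have hsN : 0 < Real.sqrt ((2 : ℝ) ^ n) := Real.sqrt_pos.2 hN
  have hηδ : (S.card : ℝ) / 2 ^ n ≤ δ :=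
    hη.trans (pow_le_of_le_one hδ (by linarith) (by norm_num))
  have hη0 : 0 ≤ (S.card : ℝ) / 2 ^ n := by positivity
  have hL : 0 < Real.sqrt (1 - (S.card : ℝ) / 2 ^ n) := Real.sqrt_pos.2 (by linarith)
  have hL1 : Real.sqrt (1 - (S.card : ℝ) / 2 ^ n) ≤ 1 := Real.sqrt_le_one.2 (by linarith)
  have hA0 := overlapSum_nonneg Finset.univ h0
  have hb0 := overlapSum_nonneg S h0
  have hA1 : overlapSum Finset.univ u / Real.sqrt (2 ^ n) ≤ 1 := by
    rw [div_le_one hsN]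
    refine Real.le_sqrt_of_sq_le ((overlapSum_sq_le_card _ h1).trans (le_of_eq ?_))
    simp
  have hbB : overlapSum S u / Real.sqrt S.card ≤ B := by
    rw [div_le_iff₀ hsM, mul_comm]
    exact overlapSum_le_of_isGreatest hne hS hB h0 h1
  -- The normalisations contribute `√N^8 = 2^n * 8^n` and `√M^4 = M^2`, so the trade-off bound `8^n
  -- M^3` becomes `M/N`.
  have hab : (overlapSum Finset.univ u / Real.sqrt (2 ^ n)) ^ 8 *
      (overlapSum S u / Real.sqrt S.card) ^ 4 ≤ δ ^ 12 := by
    refine le_trans ?_ hη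
    have e8 : Real.sqrt ((2 : ℝ) ^ n) ^ 8 = 2 ^ n * 8 ^ n := by
      rw [show Real.sqrt ((2 : ℝ) ^ n) ^ 8 = (Real.sqrt ((2 : ℝ) ^ n) ^ 2) ^ 4 by ring,
        Real.sq_sqrt hN.le, pow_succ', ← pow_mul, mul_comm n 3, pow_mul]
      norm_num
    have e4 : Real.sqrt (S.card : ℝ) ^ 4 = (S.card : ℝ) ^ 2 := by
      rw [show Real.sqrt (S.card : ℝ) ^ 4 = (Real.sqrt (S.card : ℝ) ^ 2) ^ 2 by ring,
        Real.sq_sqrt hM.le]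
    rw [div_pow, div_pow, e8, e4, div_mul_div_comm, div_le_div_iff₀ (by positivity) hN]
    calc _ ≤ (8 ^ n * (S.card : ℝ) ^ 3) * 2 ^ n :=
          mul_le_mul_of_nonneg_right (overlapSum_tradeoff S h0 h1) hN.le
      _ = _ := by ring
  have hmain := mul_add_mul_le_max_add (div_nonneg hA0 hsN.le) hA1 (div_nonneg hb0 hsM.le) hbB
    (abs_nonneg (Real.cos t)) (Real.abs_cos_le_one t) ht (Real.sin_le_one t) hδ hab
  have hm0 : 0 ≤ max |Real.cos t| (Real.sin t * B) := le_max_of_le_left (abs_nonneg _)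
  have hm1 : max |Real.cos t| (Real.sin t * B) ≤ 1 :=
    max_le (Real.abs_cos_le_one t) (by nlinarith [Real.sin_le_one t])
  have hx : ‖inner ℂ (rotatedState S t) φ‖ ≤
      (max |Real.cos t| (Real.sin t * B) + δ) / Real.sqrt (1 - (S.card : ℝ) / 2 ^ n) := by
    refine hle.trans ?_
    -- The factor `√(1 - M/N)` passes from the normalisation of `|S₀⟩` to that of `|ψ₀⟩`; the sum
    -- over unmarked strings is at most the sum over all.
    rw [abs_of_nonneg ht, sqrt_two_pow_sub_card, le_div_iff₀ hL, add_mul]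
    refine le_trans (add_le_add ?_ ?_) hmain
    · exact mul_le_of_le_one_right (mul_nonneg ht (div_nonneg hb0 hsM.le)) hL1
    · rw [mul_assoc, ← div_div, div_mul_cancel₀ _ hL.ne']
      gcongr
      linarith [overlapSum_compl S u]
  calc ‖inner ℂ (rotatedState S t) φ‖ ^ 2
      ≤ ((max |Real.cos t| (Real.sin t * B) + δ) / Real.sqrt (1 - (S.card : ℝ) / 2 ^ n)) ^ 2 := by
        gcongr
    _ = (max |Real.cos t| (Real.sin t * B) + δ) ^ 2 / (1 - (S.card : ℝ) / 2 ^ n) := by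
        rw [div_pow, Real.sq_sqrt (by linarith)]
    _ ≤ _ := sq_div_one_sub_le hm0 hm1 hδ hδ1 hη0 hηδ

/-- The overlap with `|+⟩^{⊗n}`. -/
lemma exists_mem_productOverlaps_cos {n : ℕ} (S : Finset (Fin n → Fin 2)) {t : ℝ}
    (hs : 0 ≤ Real.sin t) (hc : 0 ≤ Real.cos t) :
    ∃ r ∈ productOverlaps (rotatedState S t), Real.cos t ^ 2 - (S.card : ℝ) / 2 ^ n ≤ r := by
  have h2 : Real.sqrt 2 ^ 2 = 2 := Real.sq_sqrt zero_le_two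
  obtain ⟨φ, hφ, he⟩ := exists_isProductState_inner S t (u := fun _ _ => 1 / Real.sqrt 2)
    (fun _ => by rw [div_pow, h2]; norm_num)
  refine ⟨_, ⟨φ, hφ, rfl⟩, ?_⟩
  have hsum : ∀ T : Finset (Fin n → Fin 2), overlapSum T (fun _ _ => 1 / Real.sqrt 2) =
      (T.card : ℝ) / Real.sqrt (2 ^ n) := by
    intro T
    have : Real.sqrt ((2 : ℝ) ^ n) = Real.sqrt 2 ^ n := by
      rw [Real.sqrt_eq_iff_mul_self_eq (by positivity) (by positivity), ← mul_pow,
        Real.mul_self_sqrt zero_le_two]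
    simp [overlapSum, this, div_eq_mul_inv]
  have hη : (0 : ℝ) ≤ 1 - S.card / 2 ^ n := sub_nonneg.2 (card_div_le_one S)
  have hcompl : overlapSum Sᶜ (fun _ _ => 1 / Real.sqrt 2) / Real.sqrt (2 ^ n - S.card) =
      Real.sqrt (1 - S.card / 2 ^ n) := by
    rw [hsum, card_compl_cast, div_div, mul_comm, ← div_div, Real.div_sqrt,
      sqrt_two_pow_sub_card, mul_div_cancel_left₀ _ (by positivity)]
  rw [he, hcompl, hsum]
  have hpos : 0 ≤ Real.sin t * (S.card / Real.sqrt (2 ^ n) / Real.sqrt S.card) := by positivity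
  have hcos : Real.cos t ^ 2 * (S.card / 2 ^ n) ≤ 1 * (S.card / 2 ^ n) := by
    gcongr
    exact Real.cos_sq_le_one t
  calc Real.cos t ^ 2 - (S.card : ℝ) / 2 ^ n
      ≤ (Real.cos t * Real.sqrt (1 - S.card / 2 ^ n)) ^ 2 := by
        rw [mul_pow, Real.sq_sqrt hη]; linarith
    _ ≤ _ := by
        gcongr
        linarith

/-- The overlap with the product state closest to the marked strings. -/
lemma exists_mem_productOverlaps_sin {n : ℕ} {S : Finset (Fin n → Fin 2)} {B t h : ℝ}
    (hne : S.Nonempty) (hB : IsGreatest (markedOverlap S '' Set.Icc 0 Real.pi) B) (hB0 : 0 ≤ B)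
    (hB1 : B ≤ 1) (hs : 0 ≤ Real.sin t) (hh : 0 ≤ h) (hc : -h ≤ Real.cos t) :
    ∃ r ∈ productOverlaps (rotatedState S t), (Real.sin t * B) ^ 2 - 2 * h ≤ r := by
  obtain ⟨u, h0, h1, hu⟩ := exists_overlapSum_eq_of_isGreatest hne hB
  obtain ⟨φ, hφ, he⟩ := exists_isProductState_inner S t h1
  refine ⟨_, ⟨φ, hφ, rfl⟩, ?_⟩
  have hsM : 0 < Real.sqrt (S.card : ℝ) := Real.sqrt_pos.2 (by exact_mod_cast hne.card_pos)
  rw [he, hu, mul_div_cancel_left₀ _ hsM.ne']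
  have hA0 : 0 ≤ overlapSum Sᶜ u / Real.sqrt (2 ^ n - S.card) :=
    div_nonneg (overlapSum_nonneg _ h0) (Real.sqrt_nonneg _)
  have hA1 : overlapSum Sᶜ u / Real.sqrt (2 ^ n - S.card) ≤ 1 := by
    rw [← card_compl_cast]
    exact div_le_one_of_le₀ (Real.le_sqrt_of_sq_le (overlapSum_sq_le_card _ h1))
      (Real.sqrt_nonneg _)
  have hx0 : 0 ≤ Real.sin t * B := mul_nonneg hs hB0
  have hx1 : Real.sin t * B ≤ 1 := mul_le_one₀ (Real.sin_le_one t) hB0 hB1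
  have hy : -h ≤ Real.cos t * (overlapSum Sᶜ u / Real.sqrt (2 ^ n - S.card)) := by
    nlinarith
  -- With `x` the marked term and `y` the unmarked one, `(x + y)² ≥ x² + 2xy ≥ x² - 2h`, since `0 ≤
  -- x ≤ 1` and `y ≥ -h`.
  nlinarith [sq_nonneg (Real.cos t * (overlapSum Sᶜ u / Real.sqrt (2 ^ n - S.card)))]

/-! ### Range of the angles, and the two regimes. -/

lemma groverAngle_mem_Ioc {n : ℕ} {S : Finset (Fin n → Fin 2)} (hne : S.Nonempty) :
    groverAngle S ∈ Set.Ioc 0 (Real.pi / 2) := by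
  have hM : (0 : ℝ) < S.card := by exact_mod_cast hne.card_pos
  exact ⟨Real.arcsin_pos.2 (Real.sqrt_pos.2 (by positivity)), Real.arcsin_le_pi_div_two _⟩

/-- Rounding errs by at most `1/2`, so the rotation overshoots `π/2` by at most `θ`. Hence `cos θ_k
≥ -sin θ = -√(M/N)`, which is negligible. -/
lemma iterationAngle_le {n : ℕ} {S : Finset (Fin n → Fin 2)} (hne : S.Nonempty) {k : ℕ}
    (hk : (k : ℤ) ≤ optimalIterations S) :
    iterationAngle S k ≤ Real.pi / 2 + groverAngle S := by
  have hθ := (groverAngle_mem_Ioc hne).1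
  have hr := (abs_le.1 (abs_sub_round ((Real.pi / (2 * groverAngle S) - 1) / 2))).1
  have hk' : (k : ℝ) ≤ round ((Real.pi / (2 * groverAngle S) - 1) / 2) := by exact_mod_cast hk
  have h : 2 * (k : ℝ) ≤ Real.pi / (2 * groverAngle S) := by linarith
  rw [le_div_iff₀ (by positivity)] at h
  unfold iterationAngle
  linarith

lemma geometricEntanglement_bounds {n : ℕ} {S : Finset (Fin n → Fin 2)} {B δ : ℝ}
    (hne : S.Nonempty) (hS : IsSymmetricState (uniformState S))
    (hB : IsGreatest (markedOverlap S '' Set.Icc 0 Real.pi) B) (hB0 : 0 < B) (hB1 : B ≤ 1)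
    (hδ : 0 < δ) (hδ1 : δ ≤ 1 / 2) (hη : (S.card : ℝ) / 2 ^ n ≤ δ ^ 12)
    {k : ℕ} (hk : (k : ℤ) ≤ optimalIterations S) :
    (iterationAngle S k ≤ turningPoint S →
      |geometricEntanglement (groverState S k) - Real.sin (iterationAngle S k) ^ 2| ≤ 13 * δ) ∧
    (turningPoint S < iterationAngle S k →
      |geometricEntanglement (groverState S k) -
        (1 - (Real.sin (iterationAngle S k) * B) ^ 2)| ≤ 13 * δ) := by
  have hN : (0 : ℝ) < 2 ^ n := by positivity
  have hηδ : (S.card : ℝ) / 2 ^ n ≤ δ :=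
    hη.trans (pow_le_of_le_one hδ.le (by linarith) (by norm_num))
  have hlt : (S.card : ℝ) < 2 ^ n := (div_lt_one hN).1 (by linarith)
  have hη0 : 0 ≤ (S.card : ℝ) / 2 ^ n := by positivity
  have hh2 : Real.sqrt ((S.card : ℝ) / 2 ^ n) ^ 2 = (S.card : ℝ) / 2 ^ n := Real.sq_sqrt hη0
  have hh : Real.sqrt ((S.card : ℝ) / 2 ^ n) ≤ δ := by
    rw [Real.sqrt_le_left hδ.le]
    exact hη.trans (pow_le_pow_of_le_one hδ.le (by linarith) (by norm_num))
  obtain ⟨hθ0, hθ1⟩ := groverAngle_mem_Ioc hne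
  have ht0 : 0 ≤ iterationAngle S k := by unfold iterationAngle; positivity
  have ht1 := iterationAngle_le hne hk
  have hs : 0 ≤ Real.sin (iterationAngle S k) :=
    Real.sin_nonneg_of_nonneg_of_le_pi ht0 (by linarith)
  have hc : -Real.sqrt ((S.card : ℝ) / 2 ^ n) ≤ Real.cos (iterationAngle S k) := by
    rw [← sin_groverAngle, ← Real.cos_add_pi_div_two]
    exact Real.cos_le_cos_of_nonneg_of_le_pi ht0 (by linarith) (by linarith)
  have hT : turningPoint S = Real.arctan (1 / B) := by rw [turningPoint, hB.csSup_eq]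
  rw [groverState_eq_rotatedState hne hlt]
  set t := iterationAngle S k
  have hE : geometricEntanglement (rotatedState S t) = 1 - sSup (productOverlaps (rotatedState S t)) :=
    rfl
  have hub : ∀ r ∈ productOverlaps (rotatedState S t),
      r ≤ max |Real.cos t| (Real.sin t * B) ^ 2 + 12 * δ :=
    fun r hr => le_of_mem_productOverlaps hne hS hB hB1 hδ.le hδ1 hη hs hr
  obtain ⟨r, hr, hrle⟩ := exists_mem_productOverlaps_sin hne hB hB0.le hB1 hs
    (Real.sqrt_nonneg _) hc
  have hle := csSup_le ⟨r, hr⟩ hub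
  have hge := hrle.trans (le_csSup ⟨_, hub⟩ hr)
  rw [hE]
  constructor
  · intro hle'
    rw [hT] at hle'
    have ht2 : t < Real.pi / 2 := hle'.trans_lt (Real.arctan_lt_pi_div_two _)
    have hcpos : 0 < Real.cos t :=
      Real.cos_pos_of_mem_Ioo ⟨by linarith [Real.pi_pos], ht2⟩
    have htan : Real.tan t ≤ 1 / B := by
      rw [← Real.arctan_tan (by linarith [Real.pi_pos]) ht2] at hle'
      exact Real.arctan_strictMono.le_iff_le.1 hle'
    rw [Real.tan_eq_sin_div_cos, div_le_div_iff₀ hcpos hB0, one_mul] at htan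
    rw [abs_of_pos hcpos, max_eq_left htan] at hle
    obtain ⟨r', hr', hrle'⟩ := exists_mem_productOverlaps_cos S hs hcpos.le
    have hge' := hrle'.trans (le_csSup ⟨_, hub⟩ hr')
    have := Real.sin_sq_add_cos_sq t
    rw [abs_le]
    constructor <;> linarith
  · intro hlt'
    rw [hT] at hlt'
    -- Below `π/2` the marked term is the maximum. Past `π/2` the tangent comparison fails, but
    -- there `cos² t ≤ M/N ≤ δ`; this extra `δ` turns `12 * δ` into `13 * δ`.
    have hm : max |Real.cos t| (Real.sin t * B) ^ 2 ≤ (Real.sin t * B) ^ 2 + δ := by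
      rcases lt_or_ge t (Real.pi / 2) with ht2 | ht2
      · have hcpos : 0 < Real.cos t :=
          Real.cos_pos_of_mem_Ioo ⟨by linarith [Real.pi_pos], ht2⟩
        have htan : 1 / B < Real.tan t := by
          rw [← Real.arctan_tan (by linarith [Real.pi_pos]) ht2] at hlt'
          exact Real.arctan_strictMono.lt_iff_lt.1 hlt'
        rw [Real.tan_eq_sin_div_cos, div_lt_div_iff₀ hB0 hcpos, one_mul] at htan
        rw [abs_of_pos hcpos, max_eq_right htan.le]
        linarith
      · have hc0 : Real.cos t ≤ 0 :=
          Real.cos_nonpos_of_pi_div_two_le_of_le ht2 (by linarith)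
        have hc2 : |Real.cos t| ^ 2 ≤ δ := by
          refine le_trans ?_ (hh2.le.trans hηδ)
          rw [abs_of_nonpos hc0]
          exact pow_le_pow_left₀ (by linarith) (by linarith) 2
        rcases max_choice |Real.cos t| (Real.sin t * B) with h | h <;> rw [h]
        · linarith [sq_nonneg (Real.sin t * B)]
        · linarith
    rw [abs_le]
    constructor <;> linarith

theorem corollary2 :
    -- the turning point, explicitly in `n`, the common weight `w` and `M = |S|`
    (∀ (n w : ℕ) (S : Finset (Fin n → Fin 2)), 0 < n → S.Nonempty →
      IsSymmetricState (uniformState S) → (∀ x ∈ S, hammingNorm x = w) →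
      turningPoint S = Real.arctan
        ((1 - (w : ℝ) / n) ^ (((w : ℝ) - n) / 2) * ((w : ℝ) / n) ^ (-(w : ℝ) / 2)
          / Real.sqrt (S.card : ℝ))) ∧
    -- the entanglement when `N = 2^n` is large compared with `M`
    (∀ ε : ℝ, 0 < ε → ∃ C : ℝ, 0 < C ∧
      ∀ (n w : ℕ) (S : Finset (Fin n → Fin 2)), 0 < n → S.Nonempty →
      IsSymmetricState (uniformState S) → (∀ x ∈ S, hammingNorm x = w) →
      C * (S.card : ℝ) ≤ 2 ^ n →
      ∀ k : ℕ, (k : ℤ) ≤ optimalIterations S →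
        (iterationAngle S k ≤ turningPoint S →
          |geometricEntanglement (groverState S k) - Real.sin (iterationAngle S k) ^ 2| ≤ ε) ∧
        (turningPoint S < iterationAngle S k →
          |geometricEntanglement (groverState S k) -
            (1 - (S.card : ℝ) * Real.sin (iterationAngle S k) ^ 2 *
              (1 - (w : ℝ) / n) ^ (n - w) * ((w : ℝ) / n) ^ w)| ≤ ε)) := by
  have hwt : ∀ (n w : ℕ) (S : Finset (Fin n → Fin 2)), S.Nonempty →
      (∀ x ∈ S, hammingNorm x = w) → w ≤ n := by
    rintro n w S ⟨x, hx⟩ hw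
    exact hw x hx ▸ hammingNorm_le x
  refine ⟨fun n w S hn hne _ hw => turningPoint_eq hn (hwt n w S hne hw) hw, fun ε hε => ?_⟩
  obtain ⟨δ, hδ, hδ1, hδε⟩ : ∃ δ : ℝ, 0 < δ ∧ δ ≤ 1 / 2 ∧ 13 * δ ≤ ε :=
    ⟨min (ε / 13) (1 / 2), by positivity, min_le_right _ _, by
      linarith [min_le_left (ε / 13) (1 / 2)]⟩
  -- With this `C`, the condition `C M ≤ N` is exactly `M/N ≤ δ^12`.
  refine ⟨(δ ^ 12)⁻¹, by positivity, fun n w S hn hne hS hw hC k hk => ?_⟩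
  have hη : (S.card : ℝ) / 2 ^ n ≤ δ ^ 12 := by
    rw [inv_mul_le_iff₀ (by positivity)] at hC
    rwa [div_le_iff₀ (by positivity)]
  have hwn := hwt n w S hne hw
  have hB := markedOverlap_isGreatest hn hwn hw
  obtain ⟨hB0, hB1⟩ := overlapMax_mem_Ioc hne hn hwn hB rfl
  have hn' : (0 : ℝ) < n := by exact_mod_cast hn
  have hp1 : 0 ≤ 1 - (w : ℝ) / n :=
    sub_nonneg.2 ((div_le_one hn').2 (by exact_mod_cast hwn))
  obtain ⟨h1, h2⟩ := geometricEntanglement_bounds hne hS hB hB0 hB1 hδ hδ1 hη hk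
  refine ⟨fun h => (h1 h).trans hδε, fun h => ?_⟩
  have := (h2 h).trans hδε
  rw [mul_pow, Real.sq_sqrt (by positivity)] at this
  simpa only [mul_assoc, mul_left_comm (Real.sin (iterationAngle S k) ^ 2) (S.card : ℝ)] using this
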